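/- Let $n\ge 1$ and $[n]=\{1,\dots,n\}$, arranged on a circle. For $i\in[n]$ let $<_i$ be the total order $i<_i i+1<_i\cdots<_i n<_i 1<_i\cdots<_i i-1$. For $a,b\in[n]$ let $[a,b]=\{x: x\le_a b\}$ be the cyclic interval from $a$ to $b$, and let $(b,a)=[n]\setminus[a,b]$. A Grassmann necklace of type $(d,n)$ is a sequence $\mathcal I=(I_1,\dots,I_n)$ of $d$-subsets of $[n]$ such that, with $I_{n+1}=I_1$, for each $i$: if $i\in I_i$ then $I_{i+1}=(I_i\setminus\{i\})\cup\{j\}$ for some $j\in[n]$, and if $i\notin I_i$ then $I_{i+1}=I_i$. Let $\mathcal M$ be the positroid of rank $d$ on $[n]$ with Grassmann necklace $\mathcal I$, that is, the matroid whose bases are the $d$-subsets $B$ of $[n]$ such that, for every $j\in[n]$ and every $k\le d$, the $k$-th smallest element of $I_j$ in the order $<_j$ is $\le_j$ the $k$-th smallest element of $B$. Assume that $\mathcal M$ has no loops and no coloops. For $X\subseteq[n]$ let $\mathrm{rk}(X)$ be the rank of $X$ in $\mathcal M$, put $\mathrm{rk}(\mathcal M)=\mathrm{rk}([n])$, and let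 $\mathrm{minelts}(b,a)$ be the smallest number of elements that a basis of $\mathcal M$ can have in $(b,a)$. Let $E=[a_1,b_1]\cup\cdots\cup[a_s,b_s]$ be a disjoint union of $s$ cyclic intervals, where $a_1,b_1,a_2,b_2,\dots,a_s,b_s$ are cyclically ordered ($a_i=b_i$ being allowed), i.e. $a_1\le_c b_1<_c a_2\le_c b_2<_c\cdots<_c a_s\le_c b_s$ for some $c\in[n]$. For a non-empty set $T=\{t_1<\cdots<t_m\}\subseteq[s]$ put $E|_T=\bigcup_{t\in T}[a_t,b_t]$ and $$\mathrm{nbd}(E|_T)=\mathrm{rk}(\mathcal M)-\sum_{k=1}^m \mathrm{minelts}(b_{t_k},a_{t_{k+1}}),\qquad t_{m+1}=t_1 .$$ For a partition $\Pi$ of $[s]$ put $\mathrm{nbd}(E,\Pi)=\sum_{T\in\Pi}\mathrm{nbd}(E|_T)$. The partition $\Pi$ is non-crossing if there are no cyclically ordered $w,x,y,z\in[s]$ such that $w,y$ lie in one block of $\Pi$ and $x,z$ lie in a different block. Then: 1. $\mathrm{rk}(E)=\mathrm{nbd}(E,\Pi)$ for some non-crossing partition $\Pi$ of $[s]$. 2.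 $\mathrm{rk}(E)\le\mathrm{nbd}(E,\Pi)$ for every non-crossing partition $\Pi$ of $[s]$; hence $\mathrm{rk}(E)=\min_\Pi \mathrm{nbd}(E,\Pi)$ over all non-crossing partitions $\Pi$ of $[s]$. 3. There is exactly one decorated permutation $\pi$ (a bijection of $[n]$ whose fixed points are coloured black or white) such that, for every $k\in[n]$, $I_k$ is the set of those $j$ for which $j<_k\pi^{-1}(j)$ or $j$ is a black fixed point. It has no fixed points. For $X\subseteq[n]$ let $\mathrm{cw}(X)$ be the number of $x\in[n]$ with $[x,\pi(x)]\subseteq X$ and $\mathrm{ccw}(X)$ the number of $x\in[n]$ with $[x,\pi^{-1}(x)]\subseteq X$. Then for every non-empty $T=\{t_1<\cdots<t_m\}\subseteq[s]$, $$\mathrm{nbd}(E|_T)=\mathrm{rk}(\mathcal M)-\sum_{k=1}^m\mathrm{ccw}\bigl((b_{t_k},a_{t_{k+1}})\bigr),\qquad t_{m+1}=t_1,$$ and for every $i\in[s]$ with $[a_i,b_i]\neq[n]$, $$\mathrm{nbd}(E|_{\{i\}})=|[a_i,b_i]|-\mathrm{cw}([a_i,b_i]).$$ -/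

import Mathlib

namespace Positroid

/-! ### The cyclically shifted orders and cyclic intervals

The ground set `[n]` is `Fin n`, whose subtraction is modulo `n`, so that `x - i` is the position
of `x` in the list `i, i + 1, …, n, 1, …, i - 1`. -/

/-- `x ≤ y` in the cyclically shifted order starting at `i`. -/
def cycLE {n : ℕ} (i x y : Fin n) : Prop := x - i ≤ y - i

/-- `x < y` in the cyclically shifted order starting at `i`. -/
def cycLT {n : ℕ} (i x y : Fin n) : Prop := x - i < y - i

/-- The cyclic interval `[a, b]`. -/
def cycIcc {n : ℕ} (a b : Fin n) : Set (Fin n) := {x | cycLE a x b}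

/-- The open cyclic interval `(b, a)`: the elements strictly after `b` and strictly before `a`,
going around the circle. It is the complement of `[a, b]`; in particular `(a, a)` consists of all
elements other than `a`. -/
def cycIoo {n : ℕ} (b a : Fin n) : Set (Fin n) := (cycIcc a b)ᶜ

/-! ### Gale orders, Grassmann necklaces, positroids -/

/-- The Gale order `S ≤ T` with respect to the cyclically shifted order starting at `i`: the `j`-th
smallest element of `S` is at most the `j`-th smallest element of `T`, for every `j`. (The two
sets must have the same size.) -/
def galeLE {n : ℕ} (i : Fin n) (S T : Finset (Fin n)) : Prop :=
  List.Forall₂ (fun x y : Fin n => x ≤ y)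
    ((S.image (fun x => x - i)).sort) ((T.image (fun x => x - i)).sort)

/-- `I` is a Grassmann necklace of type `(d, n)`. -/
structure IsGrassmannNecklace {n : ℕ} [NeZero n] (d : ℕ) (I : Fin n → Finset (Fin n)) : Prop where
  card_eq : ∀ i, (I i).card = d
  step_mem : ∀ i, i ∈ I i → ∃ j, I (i + 1) = insert j (I i \ {i})
  step_notMem : ∀ i, i ∉ I i → I (i + 1) = I i

/-- `M` is the positroid of rank `d` on the ground set `[n]` with Grassmann necklace `I`: its bases
are the `d`-subsets `B` of `[n]` with `I j ≤ B` in the `j`-th Gale order, for all `j`. -/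
structure IsPositroidOf {n : ℕ} [NeZero n] (d : ℕ) (I : Fin n → Finset (Fin n))
    (M : Matroid (Fin n)) : Prop where
  necklace : IsGrassmannNecklace d I
  ground_eq : M.E = Set.univ
  isBase_iff : ∀ B : Finset (Fin n),
    M.IsBase (B : Set (Fin n)) ↔ B.card = d ∧ ∀ j, galeLE j (I j) B

/-! ### Decorated permutations and arrows -/

/-- A decorated permutation of `[n]`: a bijection with its fixed points coloured black or white
(`black` is the set of the black ones). -/
structure DecoratedPermutation (n : ℕ) where
  perm : Equiv.Perm (Fin n)
  black : Set (Fin n)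
  perm_eq_of_mem_black : ∀ j ∈ black, perm j = j

/-- `j` is a weak `i`-exceedance of `π`. -/
def DecoratedPermutation.IsWeakExceedance {n : ℕ} (π : DecoratedPermutation n) (i j : Fin n) :
    Prop :=
  cycLT i j (π.perm.symm j) ∨ j ∈ π.black

/-- `π` is the decorated permutation of the Grassmann necklace `I`: every `I k` is the set of
weak `k`-exceedances of `π`. -/
def DecoratedPermutation.IsAssociatedTo {n : ℕ} (π : DecoratedPermutation n)
    (I : Fin n → Finset (Fin n)) : Prop :=
  ∀ k j, j ∈ I k ↔ π.IsWeakExceedance k j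

/-- The number of CW-arrows `[x, π x]` contained in `T`. -/
noncomputable def DecoratedPermutation.cw {n : ℕ} (π : DecoratedPermutation n)
    (T : Set (Fin n)) : ℕ :=
  {x : Fin n | cycIcc x (π.perm x) ⊆ T}.ncard

/-- The number of CCW-arrows `[x, π⁻¹ x]` contained in `T`. -/
noncomputable def DecoratedPermutation.ccw {n : ℕ} (π : DecoratedPermutation n)
    (T : Set (Fin n)) : ℕ :=
  {x : Fin n | cycIcc x (π.perm.symm x) ⊆ T}.ncard

/-! ### Disjoint unions of cyclic intervals, non-crossing partitions, rank bounds -/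

/-- The list `a 0, b 0, a 1, b 1, …, a (s - 1), b (s - 1)` is cyclically ordered, where
`a i = b i` is allowed (the interval `[a i, b i]` may be a single point). -/
def CyclicallyOrdered {n s : ℕ} (a b : Fin s → Fin n) : Prop :=
  ∃ c : Fin n, (∀ i, cycLE c (a i) (b i)) ∧ ∀ i j, i < j → cycLT c (b i) (a j)

/-- The partition `P` of `[s]` is non-crossing. -/
def IsNonCrossing {s : ℕ} (P : Finpartition (Finset.univ : Finset (Fin s))) : Prop :=
  ∀ T ∈ P.parts, ∀ U ∈ P.parts, T ≠ U →
    ¬ ∃ i w x y z : Fin s, cycLT i w x ∧ cycLT i x y ∧ cycLT i y z ∧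
      w ∈ T ∧ y ∈ T ∧ x ∈ U ∧ z ∈ U

/-- The rank of a set, as a natural number. -/
noncomputable def rk {n : ℕ} (M : Matroid (Fin n)) (X : Set (Fin n)) : ℕ := (M.eRk X).toNat

/-- The minimal number of elements that a basis of `M` can have in `X`. -/
noncomputable def minElts {n : ℕ} (M : Matroid (Fin n)) (X : Set (Fin n)) : ℕ :=
  sInf {k : ℕ | ∃ B, M.IsBase B ∧ (B ∩ X).ncard = k}

/-- The natural rank bound of `[a 0, b 0] ∪ ⋯ ∪ [a (m - 1), b (m - 1)]`: the rank of `M` minus the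
sum over the `m` gaps `(b i, a (i + 1))` (indices modulo `m`) of the minimal number of elements of
a basis in the gap. -/
noncomputable def nbd {n m : ℕ} (M : Matroid (Fin n)) (a b : Fin m → Fin n) : ℤ :=
  (rk M M.E : ℤ) - ∑ i : Fin m, (minElts M (cycIoo (b i) (a (finRotate m i))) : ℤ)

/-- The subfamily indexed by the block `T`, in increasing order of the indices. -/
def restrictBlock {n s : ℕ} (a : Fin s → Fin n) (T : Finset (Fin s)) : Fin T.card → Fin n :=
  fun k => a (T.orderEmbOfFin rfl k)

/-- The sum over the blocks of `P` of the natural rank bounds of the unions of the intervals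
indexed by the blocks. -/
noncomputable def nbdPartition {n s : ℕ} (M : Matroid (Fin n)) (a b : Fin s → Fin n)
    (P : Finpartition (Finset.univ : Finset (Fin s))) : ℤ :=
  ∑ T ∈ P.parts, nbd M (restrictBlock a T) (restrictBlock b T)

end Positroid

/-! For every block `T`, a base spanning `E|_T` has at least `minElts` elements in each gap, so
`rk (E|_T) ≤ nbd (E|_T)`, and subadditivity of the rank gives `rk E ≤ nbd (E, Π)`.

For the converse let `B` be a base spanning `E`, and call a set tight if `B` spans it. A vector of
prefix counts belongs to a base exactly if its increments satisfy the inequalities given by the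
ranks of the cyclic intervals. If for some set of start points `a t` too few end points `b r` made
`[a t, b r]` tight, these inequalities would leave room for a base with more elements in `E` than
`B`; so Hall's theorem gives a permutation `σ` such that every `[a t, b (σ t)]` is tight. By
submodularity, two crossing tight intervals can be uncrossed, so `σ` may be taken non-crossing. Then
`σ` maps each element of an orbit to its cyclic predecessor in the orbit, tightness means that `B`
has the fewest possible elements in the gap `(b (σ t), a t)`, and summing over the orbits yields
`rk E = nbd (E, Π)` for the partition `Π` into orbits.

For the arrows, the base `I a` is tight on `[a, b]`, so it has `minElts (b, a)` elements in
`(b, a)`. An element `j` of `(b, a)` that is not a loop lies in `I a` exactly if going from `j` to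
`π⁻¹ j` does not pass through `a`, that is, if the arrow `[j, π⁻¹ j]` stays inside `(b, a)`. The
loops and the coloops are the white and the black fixed points. -/

namespace Positroid

open Finset

/-! ### Cyclic positions and cyclic intervals -/

section Position

variable {n : ℕ} {a b i p q w x y z x' y' : Fin n}

theorem val_sub_eq_ite (x i : Fin n) :
    (x - i).val = if i.val ≤ x.val then x.val - i.val else n + x.val - i.val := by
  split_ifs with h
  · exact Fin.coe_sub_iff_le.2 h
  · exact Fin.coe_sub_iff_lt.2 (not_le.1 h)

theorem val_sub_rebase (c x y : Fin n) :
    (x - y).val = if (y - c).val ≤ (x - c).val then (x - c).val - (y - c).val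
      else n + (x - c).val - (y - c).val := by
  simp only [val_sub_eq_ite]
  split_ifs <;> omega

theorem val_sub_inj {c : Fin n} (h : (x - c).val = (y - c).val) : x = y := by
  have : NeZero n := c.neZero
  exact sub_left_injective (Fin.ext h)

theorem val_sub_self (x : Fin n) : (x - x).val = 0 := by
  simp [val_sub_eq_ite]

theorem exists_val_sub_eq (c : Fin n) {k : ℕ} (hk : k < n) : ∃ x : Fin n, (x - c).val = k := by
  have : NeZero n := c.neZero
  exact ⟨⟨k, hk⟩ + c, by rw [add_sub_cancel_right]⟩

theorem val_self_sub_succ [NeZero n] (x : Fin n) : (x - (x + 1)).val + 1 = n := by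
  obtain ⟨m, rfl⟩ := Nat.exists_eq_succ_of_ne_zero (NeZero.ne n)
  simp [sub_add_cancel_left, Fin.coe_neg_one]

theorem val_succ_sub [NeZero n] (h : x + 1 ≠ z) : (x + 1 - z).val = (x - z).val + 1 := by
  have hpos : (x + 1 - z).val ≠ 0 := fun e => h (val_sub_inj (e.trans (val_sub_self z).symm))
  have hlast := val_self_sub_succ x
  rw [val_sub_rebase z x (x + 1)] at hlast
  split_ifs at hlast <;> omega

theorem mem_cycIcc_iff : x ∈ cycIcc a b ↔ (x - a).val ≤ (b - a).val := Iff.rfl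

theorem mem_cycIoo_iff : x ∈ cycIoo b a ↔ (b - a).val < (x - a).val := by
  rw [cycIoo, Set.mem_compl_iff, mem_cycIcc_iff, not_le]

theorem mem_cycIcc_iff_rebase (c : Fin n) :
    x ∈ cycIcc a b ↔ if (a - c).val ≤ (b - c).val
      then (a - c).val ≤ (x - c).val ∧ (x - c).val ≤ (b - c).val
      else (a - c).val ≤ (x - c).val ∨ (x - c).val ≤ (b - c).val := by
  rw [mem_cycIcc_iff, val_sub_rebase c x a, val_sub_rebase c b a]
  split_ifs <;> omega

theorem mem_cycIcc_iff_ite :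
    x ∈ cycIcc a b ↔ if a ≤ b then a ≤ x ∧ x ≤ b else a ≤ x ∨ x ≤ b := by
  have : NeZero n := a.neZero
  simpa using mem_cycIcc_iff_rebase (x := x) (a := a) (b := b) 0

theorem left_mem_cycIcc (a b : Fin n) : a ∈ cycIcc a b := by
  simp [mem_cycIcc_iff, val_sub_self]

theorem right_mem_cycIcc (a b : Fin n) : b ∈ cycIcc a b :=
  mem_cycIcc_iff.2 le_rfl

theorem cycIcc_self (x : Fin n) : cycIcc x x = {x} := by
  ext z
  rw [mem_cycIcc_iff, val_sub_self, Nat.le_zero, Set.mem_singleton_iff]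
  exact ⟨fun h => val_sub_inj (h.trans (val_sub_self x).symm), fun h => h ▸ val_sub_self x⟩

theorem cycIcc_succ_self [NeZero n] (x : Fin n) : cycIcc (x + 1) x = Set.univ := by
  have := val_self_sub_succ x
  exact Set.eq_univ_of_forall fun y => mem_cycIcc_iff.2 (by omega)

theorem cycIcc_uncross (hx : x' ∈ cycIcc x y) (hy : y' ∉ cycIcc x y) :
    cycIcc x y ∩ cycIcc x' y' = cycIcc x' y ∧ cycIcc x y ∪ cycIcc x' y' = cycIcc x y' := by
  have hself := val_sub_self x
  rw [mem_cycIcc_iff] at hx hy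
  constructor <;> ext z <;>
    simp only [Set.mem_inter_iff, Set.mem_union, mem_cycIcc_iff_rebase x] <;>
    split_ifs <;> omega

theorem cycIcc_subset_cycIoo_iff :
    cycIcc x y ⊆ cycIoo b a ↔ x ∈ cycIoo b a ∧ cycLE a x y := by
  have hself := val_sub_self a
  constructor
  · refine fun h => ⟨h (left_mem_cycIcc x y), not_lt.1 fun hyx => ?_⟩
    have ha : a ∈ cycIcc x y := by
      rw [mem_cycIcc_iff_rebase a, if_neg (Fin.lt_def.1 hyx).not_ge]
      omega
    have := mem_cycIoo_iff.1 (h ha)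
    omega
  · rintro ⟨hx, hxy⟩ z hz
    rw [mem_cycIcc_iff_rebase a, if_pos (Fin.le_def.1 hxy)] at hz
    rw [mem_cycIoo_iff] at hx ⊢
    omega

theorem cycIcc_subset_cycIcc_iff (hab : cycIcc a b ≠ Set.univ) :
    cycIcc x y ⊆ cycIcc a b ↔ y ∈ cycIcc a b ∧ cycLE a x y := by
  constructor
  · refine fun h => ⟨h (right_mem_cycIcc x y), not_lt.1 fun hyx => hab ?_⟩
    obtain ⟨z, hz⟩ := exists_val_sub_eq a (k := n - 1) (by omega)
    have hz' : z ∈ cycIcc x y := by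
      rw [mem_cycIcc_iff_rebase a, if_neg (Fin.lt_def.1 hyx).not_ge]
      omega
    have := mem_cycIcc_iff.1 (h hz')
    exact Set.eq_univ_of_forall fun u => mem_cycIcc_iff.2 (by omega)
  · rintro ⟨hy, hxy⟩ z hz
    rw [mem_cycIcc_iff_rebase a, if_pos (Fin.le_def.1 hxy)] at hz
    rw [mem_cycIcc_iff] at hy ⊢
    omega

theorem mem_cycIcc_or_mem_cycIcc_of_cycLT (hwx : cycLT i w x) (hxy : cycLT i x y)
    (hyz : cycLT i y z) (hw : w ∈ cycIcc p q) (hy : y ∈ cycIcc p q) :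
    x ∈ cycIcc p q ∨ z ∈ cycIcc p q := by
  simp only [cycLT, Fin.lt_def] at hwx hxy hyz
  simp only [mem_cycIcc_iff_rebase i] at hw hy ⊢
  split_ifs at hw hy ⊢ <;> omega

theorem cyc_induction [NeZero n] {P : Fin n → Prop} (hb : P b)
    (hstep : ∀ k, k + 1 ≠ b → P k → P (k + 1)) (k : Fin n) : P k := by
  induction h : (k - b).val generalizing k with
  | zero => rwa [val_sub_inj (h.trans (val_sub_self b).symm)]
  | succ m ih =>
    have hk : k - 1 + 1 = k := sub_add_cancel k 1
    have hkb : k ≠ b := by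
      rintro rfl
      rw [val_sub_self] at h
      omega
    have hpred := val_succ_sub (hk.trans_ne hkb)
    rw [← hk]
    exact hstep _ (hk.trans_ne hkb) (ih _ (by rw [hk] at hpred; omega))

theorem cyc_induction_down [NeZero n] {P : Fin n → Prop} (hb : P b)
    (hstep : ∀ k, k ≠ b → P (k + 1) → P k) (k : Fin n) : P k := by
  by_contra hk
  refine cyc_induction (P := (¬ P ·)) hk (fun j _ hj hj' => hj (hstep j ?_ hj')) b hb
  rintro rfl
  exact hj hb

end Position

/-! ### The Gale order in terms of counts -/

section Gale

variable {α : Type*} {l l' : List α} {n : ℕ}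

theorem countP_le_of_forall₂_le [Preorder α] [DecidableLE α]
    (h : List.Forall₂ (fun x y => x ≤ y) l l') (x : α) :
    l'.countP (fun y => y ≤ x) ≤ l.countP (fun y => y ≤ x) := by
  induction h with
  | nil => exact le_rfl
  | @cons u v l l' huv _ ih =>
    grind

theorem countP_le_eq_zero_of_lt [Preorder α] [DecidableLE α] {x : α} (h : ∀ y ∈ l, x < y) :
    l.countP (fun y => y ≤ x) = 0 :=
  List.countP_eq_zero.2 fun y hy => by simpa using (h y hy).not_ge

theorem forall₂_le_iff_countP [LinearOrder α] (hl : l.Pairwise (· ≤ ·))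
    (hl' : l'.Pairwise (· ≤ ·)) :
    List.Forall₂ (fun x y => x ≤ y) l l' ↔ l.length = l'.length ∧
      ∀ x, l'.countP (fun y => y ≤ x) ≤ l.countP (fun y => y ≤ x) := by
  refine ⟨fun h => ⟨h.length_eq, countP_le_of_forall₂_le h⟩, ?_⟩
  rintro ⟨hlen, hcount⟩
  induction l generalizing l' with
  | nil =>
    rw [List.eq_nil_of_length_eq_zero hlen.symm]
    exact .nil
  | cons u l ih =>
    obtain _ | ⟨v, l'⟩ := l'
    · simp at hlen
    rw [List.pairwise_cons] at hl hl'
    have huv : u ≤ v := by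
      by_contra! hvu
      have hzero := countP_le_eq_zero_of_lt fun y hy => hvu.trans_le (hl.1 y hy)
      simpa [hzero, hvu] using hcount v
    refine .cons huv (ih hl.2 hl'.2 (by simpa using hlen) fun x => ?_)
    by_cases hvx : v ≤ x
    · simpa [List.countP_cons, hvx, huv.trans hvx] using hcount x
    · have hzero := countP_le_eq_zero_of_lt fun y hy => (not_le.1 hvx).trans_le (hl'.1 y hy)
      omega

theorem countP_sort_image_sub (i x : Fin n) (S : Finset (Fin n)) :
    ((S.image (fun y => y - i)).sort).countP (fun y => y ≤ x - i) =
      ((S : Set (Fin n)) ∩ cycIcc i x).ncard := by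
  have hinj : Function.Injective (fun y : Fin n => y - i) :=
    fun y y' h => val_sub_inj (congrArg Fin.val h)
  rw [← Multiset.coe_countP, Finset.sort_eq, Finset.image_val_of_injOn hinj.injOn,
    Multiset.countP_map, ← Finset.filter_val, Finset.card_val, ← Set.ncard_coe_finset]
  congr 1
  ext y
  simp [cycIcc, cycLE]

theorem galeLE_iff (i : Fin n) (S T : Finset (Fin n)) :
    galeLE i S T ↔ S.card = T.card ∧
      ∀ x, ((T : Set (Fin n)) ∩ cycIcc i x).ncard ≤ ((S : Set (Fin n)) ∩ cycIcc i x).ncard := by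
  have : NeZero n := i.neZero
  have hinj : Function.Injective (fun y : Fin n => y - i) := sub_left_injective
  have hsort (U : Finset (Fin n)) : U.sort.Pairwise (· ≤ ·) := Finset.pairwise_sort U _
  rw [galeLE, forall₂_le_iff_countP (hsort _) (hsort _), Finset.length_sort, Finset.length_sort,
    Finset.card_image_of_injective _ hinj, Finset.card_image_of_injective _ hinj]
  refine and_congr_right fun _ => ?_
  rw [← (Equiv.subRight i).forall_congr_right]
  simp only [Equiv.subRight_apply, countP_sort_image_sub]

theorem IsPositroidOf.isBase_iff_ncard [NeZero n] {d : ℕ} {I : Fin n → Finset (Fin n)}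
    {M : Matroid (Fin n)} (hM : IsPositroidOf d I M) (B : Set (Fin n)) :
    M.IsBase B ↔ B.ncard = d ∧
      ∀ j x, (B ∩ cycIcc j x).ncard ≤ ((I j : Set (Fin n)) ∩ cycIcc j x).ncard := by
  lift B to Finset (Fin n) using B.toFinite
  rw [hM.isBase_iff, Set.ncard_coe_finset]
  refine and_congr_right fun hB => forall_congr' fun j => ?_
  simp only [galeLE_iff, hM.necklace.card_eq, hB, true_and]

end Gale

/-! ### Ranks and bases -/

section Rank

variable {n : ℕ} (M : Matroid (Fin n))

theorem coe_rk (X : Set (Fin n)) : (rk M X : ℕ∞) = M.eRk X :=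
  ENat.natCast_toNat ((M.eRk_le_encard X).trans_lt X.toFinite.encard_lt_top).ne

theorem exists_isBase_ncard_inter_eq_minElts (X : Set (Fin n)) :
    ∃ B, M.IsBase B ∧ (B ∩ X).ncard = minElts M X :=
  Nat.sInf_mem (s := {k : ℕ | ∃ B, M.IsBase B ∧ (B ∩ X).ncard = k})
    (M.exists_isBase.imp' _ fun _ hB => ⟨_, hB, rfl⟩)

theorem rk_inter_add_rk_union_le (X Y : Set (Fin n)) :
    rk M (X ∩ Y) + rk M (X ∪ Y) ≤ rk M X + rk M Y := by
  have h := M.eRk_inter_add_eRk_union_le X Y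
  simp only [← coe_rk] at h
  exact_mod_cast h

theorem rk_biUnion_le {ι : Type*} (F : Finset ι) (X : ι → Set (Fin n)) :
    rk M (⋃ i ∈ F, X i) ≤ ∑ i ∈ F, rk M (X i) := by
  classical
  induction F using Finset.induction_on with
  | empty => simp [rk]
  | insert i F hi ih =>
    rw [Finset.set_biUnion_insert, Finset.sum_insert hi]
    have := rk_inter_add_rk_union_le M (X i) (⋃ j ∈ F, X j)
    omega

theorem ncard_inter_add_ncard_inter_compl (B X : Set (Fin n)) :
    (B ∩ X).ncard + (B ∩ Xᶜ).ncard = B.ncard := by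
  rw [← Set.sdiff_eq]
  exact Set.ncard_inter_add_ncard_sdiff_eq_ncard B X

variable {M} {B X Y : Set (Fin n)}

theorem ncard_eq_rk_ground (hB : M.IsBase B) : B.ncard = rk M M.E := by
  have h := hB.encard_eq_eRank
  rw [← M.eRk_ground, ← coe_rk, ← B.toFinite.cast_ncard_eq] at h
  exact_mod_cast h

theorem ncard_inter_le_rk (hB : M.IsBase B) (X : Set (Fin n)) : (B ∩ X).ncard ≤ rk M X := by
  have h : (B ∩ X).encard ≤ M.eRk X :=
    (hB.indep.subset Set.inter_subset_left).encard_le_eRk_of_subset Set.inter_subset_right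
  rw [← coe_rk, ← (B ∩ X).toFinite.cast_ncard_eq] at h
  exact_mod_cast h

theorem minElts_le (hB : M.IsBase B) (X : Set (Fin n)) : minElts M X ≤ (B ∩ X).ncard :=
  Nat.sInf_le ⟨B, hB, rfl⟩

/-- The base `B` is tight on `X`: it spans `X`, equivalently no base has more elements in `X`. -/
def IsTight (M : Matroid (Fin n)) (B X : Set (Fin n)) : Prop := (B ∩ X).ncard = rk M X

theorem exists_isBase_isTight (M : Matroid (Fin n)) (X : Set (Fin n)) :
    ∃ B, M.IsBase B ∧ IsTight M B X := by
  obtain ⟨J, hJ⟩ := M.exists_isBasis' X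
  obtain ⟨B, hB, hJB⟩ := hJ.indep.exists_isBase_superset
  have hcard := hJ.encard_eq_eRk
  rw [← coe_rk, ← J.toFinite.cast_ncard_eq, Nat.cast_inj] at hcard
  refine ⟨B, hB, (ncard_inter_le_rk hB X).antisymm ?_⟩
  rw [← hcard]
  exact Set.ncard_le_ncard (Set.subset_inter hJB hJ.subset)

theorem rk_add_minElts_compl (M : Matroid (Fin n)) (X : Set (Fin n)) :
    rk M X + minElts M Xᶜ = rk M M.E := by
  obtain ⟨B, hB, hBX⟩ := exists_isBase_isTight M X
  obtain ⟨B', hB', hBX'⟩ := exists_isBase_ncard_inter_eq_minElts M Xᶜ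
  have hsplit := ncard_inter_add_ncard_inter_compl B X
  have hsplit' := ncard_inter_add_ncard_inter_compl B' X
  rw [ncard_eq_rk_ground hB, hBX] at hsplit
  rw [ncard_eq_rk_ground hB', hBX'] at hsplit'
  have := minElts_le hB Xᶜ
  have := ncard_inter_le_rk hB' X
  omega

theorem isTight_iff_ncard_inter_compl (hB : M.IsBase B) :
    IsTight M B X ↔ (B ∩ Xᶜ).ncard = minElts M Xᶜ := by
  have hsplit := ncard_inter_add_ncard_inter_compl B X
  have hrk := rk_add_minElts_compl M X
  rw [ncard_eq_rk_ground hB] at hsplit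
  unfold IsTight
  omega

theorem IsTight.inter_and_union (hB : M.IsBase B) (hX : IsTight M B X) (hY : IsTight M B Y) :
    IsTight M B (X ∩ Y) ∧ IsTight M B (X ∪ Y) := by
  have hsub := rk_inter_add_rk_union_le M X Y
  have hinter := ncard_inter_le_rk hB (X ∩ Y)
  have hunion := ncard_inter_le_rk hB (X ∪ Y)
  have hmod := Set.ncard_union_add_ncard_inter (B ∩ X) (B ∩ Y)
  rw [← Set.inter_union_distrib_left, ← Set.inter_inter_distrib_left] at hmod
  unfold IsTight at *
  omega

end Rank

/-! ### Prefix counts and interpolation of bases -/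

section Prefix

variable {n : ℕ}

/-- The number of elements of `B` among the first `k` elements in the cyclic order starting
at `c`. It is an integer, since the differences of its values are what matters. -/
noncomputable def prefixCount (c : Fin n) (B : Set (Fin n)) (k : ℕ) : ℤ :=
  ((B ∩ {x | (x - c).val < k}).ncard : ℤ)

variable (c : Fin n) (B : Set (Fin n))

theorem prefixCount_zero : prefixCount c B 0 = 0 := by
  simp [prefixCount]

theorem prefixCount_self : prefixCount c B n = B.ncard := by
  simp [prefixCount]

theorem prefixCount_add_ncard {p q : ℕ} (hpq : p ≤ q) :
    prefixCount c B p + (B ∩ {x | p ≤ (x - c).val ∧ (x - c).val < q}).ncard =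
      prefixCount c B q := by
  have hdisj : Disjoint {x : Fin n | (x - c).val < p} {x | p ≤ (x - c).val ∧ (x - c).val < q} :=
    Set.disjoint_left.2 fun x hx hx' => hx.not_ge hx'.1
  have hunion : {x : Fin n | (x - c).val < p} ∪ {x | p ≤ (x - c).val ∧ (x - c).val < q} =
      {x | (x - c).val < q} := by
    ext x
    simp only [Set.mem_union, Set.mem_ofPred_eq]
    omega
  rw [prefixCount, prefixCount, ← hunion, Set.inter_union_distrib_left,
    Set.ncard_union_eq (hdisj.mono Set.inter_subset_right Set.inter_subset_right), Nat.cast_add]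

theorem ncard_inter_cycIcc (x y : Fin n) :
    ((B ∩ cycIcc x y).ncard : ℤ) =
      prefixCount c B ((y - c).val + 1) - prefixCount c B (x - c).val +
        if (x - c).val ≤ (y - c).val then 0 else (B.ncard : ℤ) := by
  split_ifs with h
  · have hset : cycIcc x y = {z | (x - c).val ≤ (z - c).val ∧ (z - c).val < (y - c).val + 1} := by
      ext z
      rw [mem_cycIcc_iff_rebase c, if_pos h, Set.mem_ofPred_eq, Nat.lt_succ_iff]
    rw [← prefixCount_add_ncard c B (Nat.le_succ_of_le h), hset]
    ring
  · have hset : (cycIcc x y)ᶜ =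
        {z | (y - c).val + 1 ≤ (z - c).val ∧ (z - c).val < (x - c).val} := by
      ext z
      rw [Set.mem_compl_iff, mem_cycIcc_iff_rebase c, if_neg h, Set.mem_ofPred_eq]
      omega
    rw [← ncard_inter_add_ncard_inter_compl B (cycIcc x y),
      ← prefixCount_add_ncard c B (Nat.succ_le_of_lt (not_le.1 h)), hset]
    push_cast
    ring

open Classical in
theorem prefixCount_succ (x : Fin n) :
    prefixCount c B ((x - c).val + 1) =
      prefixCount c B (x - c).val + if x ∈ B then 1 else 0 := by
  have h := ncard_inter_cycIcc c B x x
  rw [if_pos le_rfl, cycIcc_self] at h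
  split_ifs with hx
  · rw [Set.inter_singleton_of_mem hx, Set.ncard_singleton] at h
    omega
  · rw [Set.inter_singleton_eq_empty.2 hx, Set.ncard_empty] at h
    omega

theorem prefixCount_step {k : ℕ} (hk : k < n) :
    prefixCount c B k ≤ prefixCount c B (k + 1) ∧
      prefixCount c B (k + 1) ≤ prefixCount c B k + 1 := by
  classical
  obtain ⟨x, rfl⟩ := exists_val_sub_eq c hk
  rw [prefixCount_succ]
  split_ifs <;> omega

theorem exists_prefixCount_eq {y : ℕ → ℤ} (hy : ∀ k < n, y k ≤ y (k + 1) ∧ y (k + 1) ≤ y k + 1) :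
    ∃ B : Set (Fin n), ∀ k ≤ n, prefixCount c B k = y k - y 0 := by
  classical
  refine ⟨{x | y ((x - c).val + 1) = y (x - c).val + 1}, fun k => ?_⟩
  induction k with
  | zero => simp [prefixCount_zero]
  | succ k ih =>
    intro hk
    have hstep := hy k hk
    obtain ⟨x, rfl⟩ := exists_val_sub_eq c (Nat.lt_of_succ_le hk)
    rw [prefixCount_succ, ih (by omega), Set.mem_ofPred_eq]
    split_ifs <;> omega

/-- The largest increase of the prefix count of a base of `M` from position `p` to position `q`.
It is a directed distance on positions, and it encodes the ranks of the cyclic intervals. -/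
noncomputable def maxRise (M : Matroid (Fin n)) (c : Fin n) (p q : ℕ) : ℤ :=
  ⨆ B : {B // M.IsBase B}, (prefixCount c B q - prefixCount c B p)

variable {B} {M : Matroid (Fin n)}

theorem prefixCount_sub_le_maxRise (hB : M.IsBase B) (p q : ℕ) :
    prefixCount c B q - prefixCount c B p ≤ maxRise M c p q :=
  le_ciSup (f := fun B : {B // M.IsBase B} => prefixCount c B q - prefixCount c B p)
    (Set.finite_range _).bddAbove ⟨B, hB⟩

variable (M) in
theorem exists_isBase_prefixCount_sub_eq_maxRise (p q : ℕ) :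
    ∃ B, M.IsBase B ∧ prefixCount c B q - prefixCount c B p = maxRise M c p q := by
  have : Nonempty {B // M.IsBase B} := nonempty_subtype.2 M.exists_isBase
  obtain ⟨⟨B, hB⟩, h⟩ := exists_eq_ciSup_of_finite
    (f := fun B : {B // M.IsBase B} => prefixCount c B q - prefixCount c B p)
  exact ⟨B, hB, h⟩

theorem maxRise_self (p : ℕ) : maxRise M c p p = 0 := by
  obtain ⟨B, -, h⟩ := exists_isBase_prefixCount_sub_eq_maxRise c M p p
  rw [← h, sub_self]

theorem maxRise_triangle (p q r : ℕ) : maxRise M c p r ≤ maxRise M c p q + maxRise M c q r := by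
  obtain ⟨B, hB, h⟩ := exists_isBase_prefixCount_sub_eq_maxRise c M p r
  have := prefixCount_sub_le_maxRise c hB p q
  have := prefixCount_sub_le_maxRise c hB q r
  omega

theorem maxRise_succ_le {k : ℕ} (hk : k < n) : maxRise M c k (k + 1) ≤ 1 := by
  obtain ⟨B, -, h⟩ := exists_isBase_prefixCount_sub_eq_maxRise c M k (k + 1)
  have := (prefixCount_step c B hk).2
  omega

theorem maxRise_succ_nonpos {k : ℕ} (hk : k < n) : maxRise M c (k + 1) k ≤ 0 := by
  obtain ⟨B, -, h⟩ := exists_isBase_prefixCount_sub_eq_maxRise c M (k + 1) k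
  have := (prefixCount_step c B hk).1
  omega

theorem maxRise_zero_self : maxRise M c 0 n = rk M M.E := by
  obtain ⟨B, hB, h⟩ := exists_isBase_prefixCount_sub_eq_maxRise c M 0 n
  rw [← h, prefixCount_zero, prefixCount_self, ncard_eq_rk_ground hB, sub_zero]

theorem maxRise_self_zero : maxRise M c n 0 = -rk M M.E := by
  obtain ⟨B, hB, h⟩ := exists_isBase_prefixCount_sub_eq_maxRise c M n 0
  rw [← h, prefixCount_zero, prefixCount_self, ncard_eq_rk_ground hB, zero_sub]

theorem coe_rk_cycIcc_eq_maxRise (x y : Fin n) :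
    (rk M (cycIcc x y) : ℤ) = maxRise M c (x - c).val ((y - c).val + 1) +
      if (x - c).val ≤ (y - c).val then 0 else (rk M M.E : ℤ) := by
  apply le_antisymm
  · obtain ⟨B, hB, h⟩ := exists_isBase_isTight M (cycIcc x y)
    rw [← h, ncard_inter_cycIcc c, ncard_eq_rk_ground hB]
    gcongr
    exact prefixCount_sub_le_maxRise c hB _ _
  · obtain ⟨B, hB, h⟩ := exists_isBase_prefixCount_sub_eq_maxRise c M (x - c).val ((y - c).val + 1)
    rw [← h, ← ncard_eq_rk_ground hB, ← ncard_inter_cycIcc]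
    exact_mod_cast ncard_inter_le_rk hB _

section Interpolation

variable [NeZero n] {d : ℕ} {I : Fin n → Finset (Fin n)}

theorem IsPositroidOf.isBase_iff_rk (hM : IsPositroidOf d I M) :
    M.IsBase B ↔ B.ncard = rk M M.E ∧ ∀ x y, (B ∩ cycIcc x y).ncard ≤ rk M (cycIcc x y) := by
  refine ⟨fun hB => ⟨ncard_eq_rk_ground hB, fun x y => ncard_inter_le_rk hB _⟩, ?_⟩
  rintro ⟨hcard, hle⟩
  refine (hM.isBase_iff_ncard B).2 ⟨?_, fun x y => (hle x y).trans ?_⟩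
  · obtain ⟨B', hB'⟩ := M.exists_isBase
    rw [hcard, ← ncard_eq_rk_ground hB', ((hM.isBase_iff_ncard B').1 hB').1]
  · obtain ⟨B', hB', h⟩ := exists_isBase_isTight M (cycIcc x y)
    rw [← h]
    exact ((hM.isBase_iff_ncard B').1 hB').2 x y

theorem IsPositroidOf.exists_isBase_prefixCount_eq (hM : IsPositroidOf d I M) {y : ℕ → ℤ}
    (hy : ∀ p q, y q - y p ≤ maxRise M c p q) :
    ∃ B, M.IsBase B ∧ ∀ k ≤ n, prefixCount c B k = y k - y 0 := by
  obtain ⟨B, hB⟩ := exists_prefixCount_eq c (y := y) fun k hk => by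
    have hup := (hy k (k + 1)).trans (maxRise_succ_le c hk)
    have hdown := (hy (k + 1) k).trans (maxRise_succ_nonpos c hk)
    omega
  have hcard : B.ncard = rk M M.E := by
    have hle := (hy 0 n).trans_eq (maxRise_zero_self c)
    have hge := (hy n 0).trans_eq (maxRise_self_zero c)
    have hn := hB n le_rfl
    rw [prefixCount_self] at hn
    omega
  refine ⟨B, hM.isBase_iff_rk.2 ⟨hcard, fun u v => ?_⟩, hB⟩
  zify
  rw [ncard_inter_cycIcc c, coe_rk_cycIcc_eq_maxRise c, hcard, hB _ (v - c).isLt,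
    hB _ (u - c).isLt.le]
  gcongr
  simpa using hy _ _

theorem IsPositroidOf.exists_isBase_ncard_inter_cycIcc_ge {ι κ : Type*} [Finite ι]
    (hM : IsPositroidOf d I M) (hB : M.IsBase B) (a : ι → Fin n) (b : κ → Fin n)
    (α : ι → ℤ) (β : κ → ℤ)
    (hle : ∀ t r, (B ∩ cycIcc (a t) (b r)).ncard + α t - β r ≤ rk M (cycIcc (a t) (b r))) :
    ∃ B', M.IsBase B' ∧ ∀ t r, (B ∩ cycIcc (a t) (b r)).ncard + α t - β r ≤
      (B' ∩ cycIcc (a t) (b r)).ncard := by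
  rcases isEmpty_or_nonempty ι with hι | hι
  · exact ⟨B, hB, fun t => hι.elim t⟩
  -- The largest `y` compatible with `M` such that `y ≤ prefixCount 0 B - α t` at each `a t`.
  let f (k : ℕ) (t : ι) : ℤ :=
    prefixCount 0 B (a t - 0).val - α t + maxRise M 0 (a t - 0).val k
  let y (k : ℕ) : ℤ := ⨅ t, f k t
  have hyf (k : ℕ) (t : ι) : y k ≤ f k t := ciInf_le (Set.finite_range _).bddBelow t
  have hy (p q : ℕ) : y q - y p ≤ maxRise M 0 p q := by
    obtain ⟨t, ht⟩ := exists_eq_ciInf_of_finite (f := f p)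
    have htriangle := maxRise_triangle (M := M) 0 (a t - 0).val p q
    have hyq := hyf q t
    simp only [y, f] at ht hyq ⊢
    omega
  obtain ⟨B', hB', hB'y⟩ := hM.exists_isBase_prefixCount_eq 0 hy
  refine ⟨B', hB', fun t r => ?_⟩
  have hstart : y (a t - 0).val ≤ prefixCount 0 B (a t - 0).val - α t := by
    simpa [f, maxRise_self] using hyf (a t - 0).val t
  have hend : prefixCount 0 B ((b r - 0).val + 1) - β r ≤ y ((b r - 0).val + 1) := by
    refine le_ciInf fun u => ?_
    have h := hle u r
    rw [ncard_inter_cycIcc 0, coe_rk_cycIcc_eq_maxRise 0, ncard_eq_rk_ground hB] at h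
    simp only [f]
    omega
  rw [ncard_inter_cycIcc 0, ncard_inter_cycIcc 0, ncard_eq_rk_ground hB, ncard_eq_rk_ground hB',
    hB'y _ (Nat.lt_iff_add_one_le.1 (b r - 0).isLt), hB'y _ (a t - 0).isLt.le]
  omega

end Interpolation

end Prefix

/-! ### Cyclically ordered families of intervals -/

section Family

variable {n s m : ℕ} {a b : Fin m → Fin n}

theorem ncard_inter_biUnion {ι : Type*} {X : ι → Set (Fin n)}
    (hX : Pairwise (Function.onFun Disjoint X)) (B : Set (Fin n)) (T : Finset ι) :
    (B ∩ ⋃ i ∈ T, X i).ncard = ∑ i ∈ T, (B ∩ X i).ncard := by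
  have h := T.finite_toSet.ncard_biUnion (s := fun i => B ∩ X i) (fun _ _ => Set.toFinite _)
    fun i _ j _ hij => (hX hij).mono Set.inter_subset_right Set.inter_subset_right
  rwa [finsum_mem_coe_finset, ← Set.inter_iUnion₂] at h

theorem ncard_inter_iUnion {ι : Type*} [Fintype ι] {X : ι → Set (Fin n)}
    (hX : Pairwise (Function.onFun Disjoint X)) (B : Set (Fin n)) :
    (B ∩ ⋃ i, X i).ncard = ∑ i, (B ∩ X i).ncard := by
  simpa using ncard_inter_biUnion hX B univ

theorem CyclicallyOrdered.exists_le_iff (h : CyclicallyOrdered a b) :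
    ∃ c, ∀ t r, ((a t - c).val ≤ (b r - c).val ↔ t ≤ r) ∧
      ((a t - c).val ≤ (a r - c).val ↔ t ≤ r) ∧ ((b t - c).val ≤ (b r - c).val ↔ t ≤ r) := by
  obtain ⟨c, hle, hlt⟩ := h
  simp only [cycLE, cycLT, Fin.le_def, Fin.lt_def] at hle hlt
  refine ⟨c, fun t r => ?_⟩
  have := hle t
  have := hle r
  rcases lt_trichotomy t r with htr | rfl | htr
  · have := hlt t r htr
    simp only [htr.le, iff_true]
    omega
  · simp only [le_rfl, iff_true, and_true]
    omega
  · have := hlt r t htr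
    simp only [htr.not_ge, iff_false]
    omega

theorem CyclicallyOrdered.left_mem_cycIcc_iff (h : CyclicallyOrdered a b) {t r u : Fin m} :
    a u ∈ cycIcc (a t) (b r) ↔ u ∈ cycIcc t r := by
  obtain ⟨c, hc⟩ := h.exists_le_iff
  simp only [mem_cycIcc_iff_rebase c, mem_cycIcc_iff_ite, hc]

theorem CyclicallyOrdered.right_mem_cycIcc_iff (h : CyclicallyOrdered a b) {t r u : Fin m} :
    b u ∈ cycIcc (a t) (b r) ↔ u ∈ cycIcc t r := by
  obtain ⟨c, hc⟩ := h.exists_le_iff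
  simp only [mem_cycIcc_iff_rebase c, mem_cycIcc_iff_ite, hc]

theorem CyclicallyOrdered.disjoint (h : CyclicallyOrdered a b) :
    Pairwise (Function.onFun Disjoint fun i => cycIcc (a i) (b i)) := by
  intro i j hij
  obtain ⟨c, hc⟩ := h.exists_le_iff
  refine Set.disjoint_left.2 fun x hi hj => hij ?_
  rw [mem_cycIcc_iff_rebase c, if_pos ((hc _ _).1.2 le_rfl)] at hi hj
  exact le_antisymm ((hc i j).1.1 (hi.1.trans hj.2)) ((hc j i).1.1 (hj.1.trans hi.2))

theorem CyclicallyOrdered.sum_ncard_cycIoo_perm (h : CyclicallyOrdered a b)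
    (σ : Equiv.Perm (Fin m)) (B : Set (Fin n)) :
    ∑ i, (B ∩ cycIoo (b i) (a (σ i))).ncard + (B ∩ ⋃ i, cycIcc (a i) (b i)).ncard =
      (univ.filter fun i => σ i ≤ i).card * B.ncard := by
  rw [ncard_inter_iUnion h.disjoint]
  obtain ⟨c, hc⟩ := h.exists_le_iff
  have hgap (i : Fin m) : ((B ∩ cycIoo (b i) (a (σ i))).ncard : ℤ) =
      prefixCount c B (a (σ i) - c).val - prefixCount c B ((b i - c).val + 1) +
        if σ i ≤ i then (B.ncard : ℤ) else 0 := by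
    have hsplit := ncard_inter_add_ncard_inter_compl B (cycIcc (a (σ i)) (b i))
    have hcount := ncard_inter_cycIcc c B (a (σ i)) (b i)
    simp only [(hc _ _).1] at hcount
    rw [cycIoo]
    split_ifs at hcount ⊢ <;> omega
  have harc (i : Fin m) : ((B ∩ cycIcc (a i) (b i)).ncard : ℤ) =
      prefixCount c B ((b i - c).val + 1) - prefixCount c B (a i - c).val := by
    rw [ncard_inter_cycIcc c, if_pos ((hc i i).1.2 le_rfl), add_zero]
  zify
  simp only [hgap, harc, Finset.sum_add_distrib, Finset.sum_sub_distrib, ← Finset.sum_filter,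
    Finset.sum_const, nsmul_eq_mul]
  rw [Equiv.sum_comp σ fun i => prefixCount c B (a i - c).val]
  ring

theorem card_filter_finRotate_le [NeZero m] :
    (univ.filter fun i : Fin m => finRotate m i ≤ i).card = 1 := by
  obtain ⟨k, rfl⟩ := Nat.exists_eq_succ_of_ne_zero (NeZero.ne m)
  refine Finset.card_eq_one.2 ⟨Fin.last k, ?_⟩
  ext i
  rw [Finset.mem_filter_univ, Finset.mem_singleton, ← not_lt, lt_finRotate_iff_ne_last, not_not]

theorem CyclicallyOrdered.sum_ncard_cycIoo_add_ncard_inter_iUnion [NeZero m]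
    (h : CyclicallyOrdered a b) (B : Set (Fin n)) :
    ∑ i, (B ∩ cycIoo (b i) (a (finRotate m i))).ncard + (B ∩ ⋃ i, cycIcc (a i) (b i)).ncard =
      B.ncard := by
  rw [h.sum_ncard_cycIoo_perm, card_filter_finRotate_le, one_mul]

variable {M : Matroid (Fin n)} {B : Set (Fin n)}

theorem CyclicallyOrdered.nbd_eq [NeZero m] (h : CyclicallyOrdered a b) (hB : M.IsBase B) :
    nbd M a b = (B ∩ ⋃ i, cycIcc (a i) (b i)).ncard +
      ∑ i, (((B ∩ cycIoo (b i) (a (finRotate m i))).ncard : ℤ) -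
        minElts M (cycIoo (b i) (a (finRotate m i)))) := by
  have hsum := h.sum_ncard_cycIoo_add_ncard_inter_iUnion B
  rw [ncard_eq_rk_ground hB] at hsum
  rw [nbd, ← hsum, Finset.sum_sub_distrib]
  push_cast
  ring

theorem CyclicallyOrdered.rk_le_nbd [NeZero m] (h : CyclicallyOrdered a b) :
    (rk M (⋃ i, cycIcc (a i) (b i)) : ℤ) ≤ nbd M a b := by
  obtain ⟨B, hB, hE⟩ := exists_isBase_isTight M (⋃ i, cycIcc (a i) (b i))
  rw [h.nbd_eq hB, hE]
  exact le_add_of_nonneg_right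
    (Finset.sum_nonneg fun i _ => sub_nonneg.2 (Nat.cast_le.2 (minElts_le hB _)))

theorem CyclicallyOrdered.nbd_eq_of_isTight [NeZero m] (h : CyclicallyOrdered a b)
    (hB : M.IsBase B) (htight : ∀ i, IsTight M B (cycIcc (a (finRotate m i)) (b i))) :
    nbd M a b = (B ∩ ⋃ i, cycIcc (a i) (b i)).ncard := by
  rw [h.nbd_eq hB, add_eq_left]
  refine Finset.sum_eq_zero fun i _ => sub_eq_zero.2 (Nat.cast_inj.2 ?_)
  exact (isTight_iff_ncard_inter_compl hB).1 (htight i)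

section Block

variable {a b : Fin s → Fin n}

theorem CyclicallyOrdered.restrictBlock (h : CyclicallyOrdered a b) (T : Finset (Fin s)) :
    CyclicallyOrdered (restrictBlock a T) (restrictBlock b T) := by
  obtain ⟨c, hle, hlt⟩ := h
  exact ⟨c, fun i => hle _, fun i j hij => hlt _ _ ((T.orderEmbOfFin rfl).strictMono hij)⟩

theorem iUnion_cycIcc_restrictBlock (a b : Fin s → Fin n) (T : Finset (Fin s)) :
    ⋃ i, cycIcc (Positroid.restrictBlock a T i) (Positroid.restrictBlock b T i) =
      ⋃ t ∈ T, cycIcc (a t) (b t) := by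
  have h := Set.biUnion_range (f := T.orderEmbOfFin rfl) (g := fun t => cycIcc (a t) (b t))
  rw [Finset.range_orderEmbOfFin] at h
  exact h.symm

theorem nbd_restrictBlock_singleton (M : Matroid (Fin n)) (a b : Fin s → Fin n) (i : Fin s) :
    nbd M (Positroid.restrictBlock a {i}) (Positroid.restrictBlock b {i}) =
      rk M (cycIcc (a i) (b i)) := by
  have hblock (f : Fin s → Fin n) (k : Fin ({i} : Finset (Fin s)).card) :
      Positroid.restrictBlock f {i} k = f i := by
    rw [Positroid.restrictBlock, Finset.mem_singleton.1 (Finset.orderEmbOfFin_mem {i} rfl k)]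
  rw [nbd, ← rk_add_minElts_compl M (cycIcc (a i) (b i))]
  simp [hblock, cycIoo]

theorem CyclicallyOrdered.rk_le_nbdPartition (h : CyclicallyOrdered a b)
    (P : Finpartition (univ : Finset (Fin s))) :
    (rk M (⋃ i, cycIcc (a i) (b i)) : ℤ) ≤ nbdPartition M a b P := by
  have hunion : (⋃ i, cycIcc (a i) (b i)) = ⋃ T ∈ P.parts, ⋃ t ∈ T, cycIcc (a t) (b t) := by
    have hparts : (P.parts.biUnion fun T => T) = univ := P.biUnion_parts
    rw [← Finset.set_biUnion_biUnion, hparts]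
    simp
  calc (rk M (⋃ i, cycIcc (a i) (b i)) : ℤ)
      ≤ ∑ T ∈ P.parts, (rk M (⋃ t ∈ T, cycIcc (a t) (b t)) : ℤ) := by
        rw [hunion]
        exact_mod_cast rk_biUnion_le M P.parts _
    _ ≤ nbdPartition M a b P := Finset.sum_le_sum fun T hT => by
        have : NeZero T.card := ⟨Finset.card_ne_zero.2 (P.nonempty_of_mem_parts hT)⟩
        rw [← iUnion_cycIcc_restrictBlock]
        exact (h.restrictBlock T).rk_le_nbd

end Block

end Family

/-! ### Matching start points with end points by tight arcs -/

theorem IsPositroidOf.exists_perm_isTight {n d : ℕ} [NeZero n] {I : Fin n → Finset (Fin n)}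
    {M : Matroid (Fin n)} (hM : IsPositroidOf d I M) {ι : Type*} [Finite ι] {a b : ι → Fin n}
    (hdisj : Pairwise (Function.onFun Disjoint fun i => cycIcc (a i) (b i)))
    {B : Set (Fin n)} (hB : M.IsBase B) (hE : IsTight M B (⋃ i, cycIcc (a i) (b i))) :
    ∃ σ : Equiv.Perm ι, ∀ t, IsTight M B (cycIcc (a t) (b (σ t))) := by
  classical
  have := Fintype.ofFinite ι
  let N (t : ι) : Finset ι := univ.filter fun r => IsTight M B (cycIcc (a t) (b r))
  suffices hall : ∀ S : Finset ι, S.card ≤ (S.biUnion N).card by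
    obtain ⟨f, hf, hfN⟩ := (Finset.all_card_le_biUnion_card_iff_exists_injective N).1 hall
    exact ⟨.ofBijective f (Finite.injective_iff_bijective.1 hf), fun t =>
      (Finset.mem_filter.1 (hfN t)).2⟩
  intro S
  obtain ⟨B', hB', hle⟩ := hM.exists_isBase_ncard_inter_cycIcc_ge hB a b
    (fun t => if t ∈ S then 1 else 0) (fun r => if r ∈ S.biUnion N then 1 else 0)
    fun t r => by
      have hrk := ncard_inter_le_rk hB (cycIcc (a t) (b r))
      have htight : t ∈ S → r ∉ S.biUnion N →
          (B ∩ cycIcc (a t) (b r)).ncard ≠ rk M (cycIcc (a t) (b r)) := fun ht hr heq =>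
        hr (Finset.mem_biUnion.2 ⟨t, ht, Finset.mem_filter.2 ⟨mem_univ _, heq⟩⟩)
      split_ifs with ht hr hr
      all_goals first | omega | have := htight ht hr; omega
  have hgain : ((B ∩ ⋃ i, cycIcc (a i) (b i)).ncard : ℤ) + S.card - (S.biUnion N).card ≤
      (B' ∩ ⋃ i, cycIcc (a i) (b i)).ncard := by
    rw [ncard_inter_iUnion hdisj, ncard_inter_iUnion hdisj]
    simpa [Finset.sum_add_distrib, Finset.sum_sub_distrib, -mem_biUnion] using
      Finset.sum_le_sum fun t (_ : t ∈ univ) => hle t t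
  have hmax := ncard_inter_le_rk hB' (⋃ i, cycIcc (a i) (b i))
  rw [← hE] at hmax
  omega

/-! ### Non-crossing permutations and their orbit partitions -/

section NonCrossing

variable {s : ℕ} {σ : Equiv.Perm (Fin s)} {T : Finset (Fin s)} {t u x : Fin s}

/-- A permutation of the circle `[s]` is non-crossing if no arc `[x, σ x]` starts inside an arc
`[t, σ t]` and ends outside it. -/
def IsNonCrossingPerm (σ : Equiv.Perm (Fin s)) : Prop :=
  ∀ t, Set.MapsTo σ (cycIcc t (σ t)) (cycIcc t (σ t))

theorem sum_mul_swap {ι N : Type*} [Fintype ι] [DecidableEq ι] [AddCommMonoid N]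
    (f : ι → ι → N) (σ : Equiv.Perm ι) {t t' : ι} (htt' : t ≠ t') :
    ∑ x, f x ((σ * Equiv.swap t t') x) + (f t (σ t) + f t' (σ t')) =
      ∑ x, f x (σ x) + (f t (σ t') + f t' (σ t)) := by
  have hrest : ∑ x ∈ {t, t'}ᶜ, f x ((σ * Equiv.swap t t') x) = ∑ x ∈ {t, t'}ᶜ, f x (σ x) := by
    refine Finset.sum_congr rfl fun x hx => ?_
    simp only [Finset.mem_compl, Finset.mem_insert, Finset.mem_singleton, not_or] at hx
    rw [Equiv.Perm.mul_apply, Equiv.swap_apply_of_ne_of_ne hx.1 hx.2]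
  rw [← Finset.sum_add_sum_compl {t, t'}, ← Finset.sum_add_sum_compl {t, t'} fun x => f x (σ x),
    Finset.sum_pair htt', Finset.sum_pair htt', hrest]
  simp only [Equiv.Perm.mul_apply, Equiv.swap_apply_left, Equiv.swap_apply_right]
  abel

-- Uncrossing two arcs makes the longer one longer, so it increases the sum of the squared lengths.
theorem exists_isNonCrossingPerm {R : Fin s → Fin s → Prop}
    (hR : ∀ t t' r r', R t r → R t' r' → t' ∈ cycIcc t r → r' ∉ cycIcc t r → R t r' ∧ R t' r)
    (h : ∃ σ : Equiv.Perm (Fin s), ∀ t, R t (σ t)) :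
    ∃ σ : Equiv.Perm (Fin s), (∀ t, R t (σ t)) ∧ IsNonCrossingPerm σ := by
  obtain ⟨σ, hσ, hmax⟩ := Set.exists_max_image {σ : Equiv.Perm (Fin s) | ∀ t, R t (σ t)}
    (fun σ => ∑ t, (σ t - t).val ^ 2) (Set.toFinite _) h
  refine ⟨σ, hσ, fun t t' ht' => by_contra fun hr' => ?_⟩
  have htt' : t ≠ t' := fun e => hr' (e ▸ right_mem_cycIcc _ _)
  obtain ⟨hR₁, hR₂⟩ := hR t t' _ _ (hσ t) (hσ t') ht' hr'
  have hswap : ∀ x, R x ((σ * Equiv.swap t t') x) := by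
    intro x
    rw [Equiv.Perm.mul_apply, Equiv.swap_apply_def]
    split_ifs with hxt hxt'
    · rwa [hxt]
    · rwa [hxt']
    · exact hσ x
  have hle := hmax _ hswap
  have hsum := sum_mul_swap (fun x y : Fin s => (y - x).val ^ 2) σ htt'
  suffices (σ t - t).val ^ 2 + (σ t' - t').val ^ 2 < (σ t' - t).val ^ 2 + (σ t - t').val ^ 2 by
    omega
  rw [mem_cycIcc_iff] at ht' hr'
  have hpos : (t' - t).val ≠ 0 := fun e => htt' (val_sub_inj (e.trans (val_sub_self t).symm)).symm
  rw [val_sub_rebase t (σ t) t', val_sub_rebase t (σ t') t', if_pos ht', if_pos (by omega)]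
  generalize (σ t - t).val = p at *
  generalize (σ t' - t).val = q at *
  obtain ⟨k, rfl⟩ := Nat.exists_eq_add_of_le ht'
  obtain ⟨l, rfl⟩ := Nat.exists_eq_add_of_lt (not_le.1 hr')
  rw [Nat.add_sub_cancel_left, add_assoc, add_assoc, Nat.add_sub_cancel_left]
  nlinarith [Nat.pos_of_ne_zero hpos]

open Classical in
/-- The partition of `[s]` into the orbits of `σ`. -/
noncomputable def orbitPartition (σ : Equiv.Perm (Fin s)) :
    Finpartition (univ : Finset (Fin s)) :=
  Finpartition.ofSetoid (Equiv.Perm.SameCycle.setoid σ)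

theorem mem_iff_sameCycle_of_mem_parts (hT : T ∈ (orbitPartition σ).parts) (ht : t ∈ T) :
    u ∈ T ↔ σ.SameCycle t u := by
  classical
  rw [← (orbitPartition σ).part_eq_of_mem hT ht]
  exact Finpartition.mem_part_ofSetoid_iff_rel (s := Equiv.Perm.SameCycle.setoid σ)

theorem apply_mem_of_mem_parts (hT : T ∈ (orbitPartition σ).parts) (ht : t ∈ T) : σ t ∈ T :=
  (mem_iff_sameCycle_of_mem_parts hT ht).2 (Equiv.Perm.sameCycle_apply_right.2 (.refl _ _))

theorem IsNonCrossingPerm.subset_cycIcc (hσ : IsNonCrossingPerm σ)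
    (hT : T ∈ (orbitPartition σ).parts) (hu : u ∈ T) (hut : u ∈ cycIcc t (σ t)) :
    ↑T ⊆ cycIcc t (σ t) := by
  intro v hv
  obtain ⟨k, rfl⟩ := ((mem_iff_sameCycle_of_mem_parts hT hu).1 hv).exists_nat_pow_eq
  rw [Equiv.Perm.coe_pow]
  exact (hσ t).iterate k hut

theorem exists_mem_notMem_cycIcc (hT : T ∈ (orbitPartition σ).parts) (hx : x ∉ T) :
    ∃ t ∈ T, x ∉ cycIcc t (σ t) := by
  obtain ⟨t, ht, hmin⟩ := Finset.exists_min_image T (fun v => (v - x).val)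
    ((orbitPartition σ).nonempty_of_mem_parts hT)
  refine ⟨t, ht, fun hxt => hx ?_⟩
  rw [mem_cycIcc_iff_rebase x, if_pos (hmin _ (apply_mem_of_mem_parts hT ht)), val_sub_self] at hxt
  rwa [← val_sub_inj ((Nat.le_zero.1 hxt.1).trans (val_sub_self x).symm)]

theorem IsNonCrossingPerm.isNonCrossing_orbitPartition (hσ : IsNonCrossingPerm σ) :
    IsNonCrossing (orbitPartition σ) := by
  rintro T hT U hU hTU ⟨i, w, x, y, z, hwx, hxy, hyz, hw, hy, hx, hz⟩
  have hxT : x ∉ T := fun h => hTU ((orbitPartition σ).eq_of_mem_parts hT hU h hx)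
  obtain ⟨t, ht, hxt⟩ := exists_mem_notMem_cycIcc hT hxT
  have hTt := hσ.subset_cycIcc hT ht (left_mem_cycIcc t _)
  rcases mem_cycIcc_or_mem_cycIcc_of_cycLT hwx hxy hyz (hTt hw) (hTt hy) with h | h
  · exact hxt h
  · exact hxt (hσ.subset_cycIcc hU hz h hx)

theorem cyclicallyOrdered_of_strictMono [NeZero s] {m : ℕ} {f : Fin m → Fin s}
    (hf : StrictMono f) : CyclicallyOrdered f f := by
  refine ⟨0, fun i => le_rfl, fun i j hij => ?_⟩
  simpa only [cycLT, sub_zero] using hf hij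

theorem cycIcc_finRotate_self {m : ℕ} (k : Fin m) : cycIcc (finRotate m k) k = Set.univ := by
  have : NeZero m := k.neZero
  obtain ⟨m, rfl⟩ := Nat.exists_eq_succ_of_ne_zero (NeZero.ne m)
  rw [finRotate_apply, cycIcc_succ_self]

theorem IsNonCrossingPerm.apply_orderEmbOfFin_finRotate (hσ : IsNonCrossingPerm σ)
    (hT : T ∈ (orbitPartition σ).parts) (k : Fin T.card) :
    σ (T.orderEmbOfFin rfl (finRotate T.card k)) = T.orderEmbOfFin rfl k := by
  have : NeZero s := (T.orderEmbOfFin rfl k).neZero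
  have hcyc := cyclicallyOrdered_of_strictMono (T.orderEmbOfFin rfl).strictMono
  set t := T.orderEmbOfFin rfl (finRotate T.card k) with ht
  have htT : t ∈ T := T.orderEmbOfFin_mem rfl _
  have hlast : σ t ∈ cycIcc t (T.orderEmbOfFin rfl k) := by
    obtain ⟨l, hl⟩ : σ t ∈ Set.range (T.orderEmbOfFin rfl) := by
      rw [Finset.range_orderEmbOfFin]
      exact apply_mem_of_mem_parts hT htT
    rw [← hl, ht, hcyc.left_mem_cycIcc_iff, cycIcc_finRotate_self]
    trivial
  exact val_sub_inj (le_antisymm hlast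
    (hσ.subset_cycIcc hT htT (left_mem_cycIcc t _) (T.orderEmbOfFin_mem rfl k)))

end NonCrossing

theorem IsPositroidOf.exists_isNonCrossing_rk_eq {n s d : ℕ} [NeZero n]
    {I : Fin n → Finset (Fin n)} {M : Matroid (Fin n)} (hM : IsPositroidOf d I M)
    {a b : Fin s → Fin n} (h : CyclicallyOrdered a b) :
    ∃ P : Finpartition (univ : Finset (Fin s)), IsNonCrossing P ∧
      (rk M (⋃ i, cycIcc (a i) (b i)) : ℤ) = nbdPartition M a b P := by
  obtain ⟨B, hB, hE⟩ := exists_isBase_isTight M (⋃ i, cycIcc (a i) (b i))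
  obtain ⟨σ, hσ, hnc⟩ := exists_isNonCrossingPerm
    (R := fun t r => IsTight M B (cycIcc (a t) (b r)))
    (fun t t' r r' htr htr' ht' hr' => by
      obtain ⟨hinter, hunion⟩ := cycIcc_uncross (h.left_mem_cycIcc_iff.2 ht')
        (mt h.right_mem_cycIcc_iff.1 hr')
      have huncross := htr.inter_and_union hB htr'
      rw [hinter, hunion] at huncross
      exact huncross.symm)
    (hM.exists_perm_isTight h.disjoint hB hE)
  refine ⟨orbitPartition σ, hnc.isNonCrossing_orbitPartition, ?_⟩
  have hblock : ∀ T ∈ (orbitPartition σ).parts, nbd M (restrictBlock a T) (restrictBlock b T) =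
      ∑ t ∈ T, ((B ∩ cycIcc (a t) (b t)).ncard : ℤ) := by
    intro T hT
    have : NeZero T.card := ⟨Finset.card_ne_zero.2 ((orbitPartition σ).nonempty_of_mem_parts hT)⟩
    rw [(h.restrictBlock T).nbd_eq_of_isTight hB fun k => ?_, iUnion_cycIcc_restrictBlock,
      ncard_inter_biUnion h.disjoint, Nat.cast_sum]
    have htight := hσ (T.orderEmbOfFin rfl (finRotate T.card k))
    rwa [hnc.apply_orderEmbOfFin_finRotate hT] at htight
  have hsum := Finset.sum_biUnion (f := fun t => ((B ∩ cycIcc (a t) (b t)).ncard : ℤ))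
    (orbitPartition σ).disjoint
  rw [(orbitPartition σ).biUnion_parts] at hsum
  rw [nbdPartition, Finset.sum_congr rfl hblock, ← hE, ncard_inter_iUnion h.disjoint, Nat.cast_sum]
  exact hsum

/-! ### Grassmann necklaces of positroids -/

section Necklace

variable {n d : ℕ} [NeZero n] {I : Fin n → Finset (Fin n)} {i j k x y : Fin n}
  {X : Set (Fin n)}

theorem IsGrassmannNecklace.mem_succ (hI : IsGrassmannNecklace d I) (hj : j ∈ I k) (hjk : j ≠ k) :
    j ∈ I (k + 1) := by
  by_cases hk : k ∈ I k
  · obtain ⟨i, hi⟩ := hI.step_mem k hk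
    rw [hi]
    exact mem_insert_of_mem (mem_sdiff.2 ⟨hj, notMem_singleton.2 hjk⟩)
  · rwa [hI.step_notMem k hk]

theorem IsGrassmannNecklace.mem_of_cycLE (hI : IsGrassmannNecklace d I) (hx : j ∈ I x)
    (hxy : cycLE (j + 1) x y) : j ∈ I y := by
  induction y using cyc_induction (b := x) with
  | hb => exact hx
  | hstep k hkx ih =>
    have hne : (x - (j + 1)).val ≠ (k + 1 - (j + 1)).val := fun e => hkx (val_sub_inj e).symm
    rw [cycLE, Fin.le_def] at ih hxy
    have hkj : k + 1 ≠ j + 1 := by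
      intro e
      rw [e, val_sub_self] at hne hxy
      omega
    rw [val_succ_sub hkj] at hne hxy
    exact hI.mem_succ (ih (by omega)) fun e => hkj (e ▸ rfl)

theorem IsGrassmannNecklace.mem_self (hI : IsGrassmannNecklace d I) (h : j ∈ I k) : j ∈ I j := by
  have hlast := val_self_sub_succ j
  exact hI.mem_of_cycLE h (Fin.le_def.2 (by omega))

theorem IsGrassmannNecklace.mem_of_mem_succ (hI : IsGrassmannNecklace d I) (h : j ∈ I (j + 1)) :
    j ∈ I k :=
  hI.mem_of_cycLE h (Fin.le_def.2 (by simp))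

theorem IsGrassmannNecklace.ncard_succ_inter_le (hI : IsGrassmannNecklace d I) (hk : k ∈ X) :
    ((I (k + 1) : Set (Fin n)) ∩ X).ncard ≤ ((I k : Set (Fin n)) ∩ X).ncard := by
  by_cases hkI : k ∈ I k
  · obtain ⟨j, hj⟩ := hI.step_mem k hkI
    have hsub : (I (k + 1) : Set (Fin n)) ∩ X ⊆ insert j (((I k : Set (Fin n)) ∩ X) \ {k}) := by
      rw [hj, coe_insert, coe_sdiff, coe_singleton]
      rintro x ⟨rfl | hx, hxX⟩
      · exact Or.inl rfl
      · exact Or.inr ⟨⟨hx.1, hxX⟩, hx.2⟩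
    calc ((I (k + 1) : Set (Fin n)) ∩ X).ncard
        ≤ (((I k : Set (Fin n)) ∩ X) \ {k}).ncard + 1 :=
          (Set.ncard_le_ncard hsub).trans (Set.ncard_insert_le _ _)
      _ = ((I k : Set (Fin n)) ∩ X).ncard := Set.ncard_sdiff_singleton_add_one ⟨hkI, hk⟩
  · rw [hI.step_notMem k hkI]

theorem IsGrassmannNecklace.ncard_inter_le_succ (hI : IsGrassmannNecklace d I) (hk : k ∉ X) :
    ((I k : Set (Fin n)) ∩ X).ncard ≤ ((I (k + 1) : Set (Fin n)) ∩ X).ncard :=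
  Set.ncard_le_ncard fun _ ⟨hx, hxX⟩ => ⟨hI.mem_succ hx fun e => hk (e ▸ hxX), hxX⟩

theorem IsGrassmannNecklace.ncard_inter_cycIcc_le (hI : IsGrassmannNecklace d I) (k j x : Fin n) :
    ((I k : Set (Fin n)) ∩ cycIcc j x).ncard ≤ ((I j : Set (Fin n)) ∩ cycIcc j x).ncard := by
  by_cases hk : k ∈ cycIcc j x
  · induction k using cyc_induction (b := j) with
    | hb => rfl
    | hstep k hkj ih =>
      rw [mem_cycIcc_iff, val_succ_sub hkj] at hk
      have hk' : k ∈ cycIcc j x := mem_cycIcc_iff.2 (by omega)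
      exact (hI.ncard_succ_inter_le hk').trans (ih hk')
  · induction k using cyc_induction_down (b := j) with
    | hb => rfl
    | hstep k _ ih =>
      refine (hI.ncard_inter_le_succ hk).trans ?_
      rcases eq_or_ne (k + 1) j with hne | hne
      · rw [hne]
      · refine ih fun hmem => hk ?_
        rw [mem_cycIcc_iff, val_succ_sub hne] at hmem
        exact mem_cycIcc_iff.2 (by omega)

variable {M : Matroid (Fin n)}

theorem IsPositroidOf.isBase_necklace (hM : IsPositroidOf d I M) (k : Fin n) :
    M.IsBase (I k : Set (Fin n)) := by
  rw [hM.isBase_iff_ncard, Set.ncard_coe_finset]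
  exact ⟨hM.necklace.card_eq k, hM.necklace.ncard_inter_cycIcc_le k⟩

theorem IsPositroidOf.isTight_necklace (hM : IsPositroidOf d I M) (a b : Fin n) :
    IsTight M (I a) (cycIcc a b) := by
  refine le_antisymm (ncard_inter_le_rk (hM.isBase_necklace a) _) ?_
  obtain ⟨B, hB, hBab⟩ := exists_isBase_isTight M (cycIcc a b)
  exact hBab ▸ ((hM.isBase_iff_ncard B).1 hB).2 a b

theorem IsPositroidOf.isLoop_iff (hM : IsPositroidOf d I M) : M.IsLoop x ↔ x ∉ I x := by
  rw [Matroid.isLoop_iff_forall_mem_compl_isBase]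
  constructor
  · exact fun h => (h _ (hM.isBase_necklace x)).2
  · refine fun hx B hB => ⟨hM.ground_eq ▸ Set.mem_univ x, fun hxB => ?_⟩
    have hle := ((hM.isBase_iff_ncard B).1 hB).2 x x
    rw [cycIcc_self, Set.inter_singleton_of_mem hxB, Set.ncard_singleton,
      Set.inter_singleton_of_notMem (mem_coe.not.2 hx), Set.ncard_empty] at hle
    omega

theorem IsPositroidOf.isColoop_iff (hM : IsPositroidOf d I M) : M.IsColoop x ↔ x ∈ I (x + 1) := by
  rw [Matroid.isColoop_iff_forall_mem_isBase]
  refine ⟨fun h => h (hM.isBase_necklace (x + 1)), fun hx B hB => by_contra fun hxB => ?_⟩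
  obtain ⟨hBd, hBI⟩ := (hM.isBase_iff_ncard B).1 hB
  rw [← hM.necklace.card_eq (x + 1), ← Set.ncard_coe_finset] at hBd
  have hBne : B.Nonempty := by
    rw [← Set.ncard_pos, hBd, Set.ncard_coe_finset, card_pos]
    exact ⟨x, hx⟩
  obtain ⟨y, hy, hmax⟩ := Set.exists_max_image B (fun z => z - (x + 1)) (Set.toFinite B) hBne
  have hle := hBI (x + 1) y
  rw [Set.inter_eq_left.2 (show B ⊆ cycIcc (x + 1) y from hmax), hBd] at hle
  have hxy := Set.inter_eq_left.1 (Set.eq_of_subset_of_ncard_le Set.inter_subset_left hle) hx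
  have hlast := val_self_sub_succ x
  rw [mem_cycIcc_iff] at hxy
  have hyx : y = x := val_sub_inj (c := x + 1) (by omega)
  exact hxB (hyx ▸ hy)

end Necklace

/-! ### The decorated permutation of a Grassmann necklace -/

section Existence

variable {n d : ℕ} [NeZero n] {I : Fin n → Finset (Fin n)} {i j : Fin n}

theorem IsGrassmannNecklace.notMem_of_succ_eq_insert (hI : IsGrassmannNecklace d I) (hi : i ∈ I i)
    (h : I (i + 1) = insert j (I i \ {i})) (hji : j ≠ i) : j ∉ I i := by
  intro hj
  rw [insert_eq_of_mem (mem_sdiff.2 ⟨hj, notMem_singleton.2 hji⟩)] at h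
  have hlt := card_lt_card (sdiff_ssubset (singleton_subset_iff.2 hi) (singleton_nonempty i))
  rw [← h, hI.card_eq, hI.card_eq] at hlt
  exact lt_irrefl d hlt

theorem IsGrassmannNecklace.mem_iff_cycLT (hI : IsGrassmannNecklace d I) (hi : j ∉ I i)
    (hi' : j ∈ I (i + 1)) (k : Fin n) : j ∈ I k ↔ cycLT k j i := by
  have hji : j + 1 ≠ i + 1 := by
    intro e
    obtain rfl := add_left_injective 1 e
    exact hi (hI.mem_self hi')
  have hsucc := val_succ_sub hji.symm
  have hmem : j ∈ I k ↔ (i - (j + 1)).val < (k - (j + 1)).val := by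
    constructor
    · exact fun hk => not_le.1 fun hle => hi (hI.mem_of_cycLE hk hle)
    · exact fun hlt => hI.mem_of_cycLE hi' (Fin.le_def.2 (by omega))
  have hlast := val_self_sub_succ j
  rw [hmem, cycLT, Fin.lt_def, val_sub_rebase (j + 1) j k, val_sub_rebase (j + 1) i k]
  split_ifs <;> omega

theorem IsGrassmannNecklace.exists_perm (hI : IsGrassmannNecklace d I) :
    ∃ σ : Equiv.Perm (Fin n), ∀ i, (i ∈ I i → I (i + 1) = insert (σ i) (I i \ {i})) ∧
      (i ∉ I i → σ i = i) := by
  have hex (i : Fin n) : ∃ j, (i ∈ I i → I (i + 1) = insert j (I i \ {i})) ∧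
      (i ∉ I i → j = i) := by
    by_cases hi : i ∈ I i
    · obtain ⟨j, hj⟩ := hI.step_mem i hi
      exact ⟨j, fun _ => hj, absurd hi⟩
    · exact ⟨i, fun h => absurd h hi, fun _ => rfl⟩
  choose f hf hf' using hex
  suffices hsurj : Function.Surjective f from
    ⟨.ofBijective f (Finite.surjective_iff_bijective.1 hsurj), fun i => ⟨hf i, hf' i⟩⟩
  intro j
  by_cases hj : j ∈ I j
  · obtain ⟨i, hji, hji'⟩ : ∃ i, j ∉ I i \ {i} ∧ j ∈ I (i + 1) := by
      by_contra! hstay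
      refine cyc_induction (b := j + 1) (P := (j ∉ I ·)) (hstay j (by simp))
        (fun k _ hk => hstay k fun h => hk (mem_sdiff.1 h).1) j hj
    have hi : i ∈ I i := by
      by_contra hi
      rw [hI.step_notMem i hi] at hji'
      exact hji (mem_sdiff.2 ⟨hji', notMem_singleton.2 fun e => hi (e ▸ hj)⟩)
    rw [hf i hi] at hji'
    exact ⟨i, ((mem_insert.1 hji').resolve_right hji).symm⟩
  · exact ⟨j, hf' j hj⟩

theorem IsGrassmannNecklace.exists_isAssociatedTo (hI : IsGrassmannNecklace d I) :
    ∃ π : DecoratedPermutation n, π.IsAssociatedTo I := by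
  obtain ⟨σ, hσ⟩ := hI.exists_perm
  refine ⟨⟨σ, {j | σ j = j ∧ j ∈ I j}, fun _ => And.left⟩, fun k j => ?_⟩
  obtain ⟨i, rfl⟩ := σ.surjective j
  change _ ↔ cycLT k (σ i) (σ.symm (σ i)) ∨ σ (σ i) = σ i ∧ σ i ∈ I (σ i)
  rw [Equiv.symm_apply_apply, σ.apply_eq_iff_eq]
  by_cases hfix : σ i = i
  · rw [hfix]
    have hmem (hi : i ∈ I i) : i ∈ I k :=
      hI.mem_of_mem_succ (by rw [(hσ i).1 hi, hfix]; exact mem_insert_self _ _)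
    simp only [cycLT, lt_irrefl, false_or, true_and]
    exact ⟨hI.mem_self, hmem⟩
  · have hi : i ∈ I i := by_contra fun hi => hfix ((hσ i).2 hi)
    have hstep := (hσ i).1 hi
    rw [hI.mem_iff_cycLT (hI.notMem_of_succ_eq_insert hi hstep hfix)
      (hstep ▸ mem_insert_self _ _), or_iff_left fun h => hfix h.1]

end Existence

namespace DecoratedPermutation.IsAssociatedTo

variable {n : ℕ} {I : Fin n → Finset (Fin n)} {π π' : DecoratedPermutation n} {i j x : Fin n}

theorem mem_iff (hπ : π.IsAssociatedTo I) (k j : Fin n) :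
    j ∈ I k ↔ (j - k).val < (π.perm.symm j - k).val ∨ j ∈ π.black :=
  hπ k j

theorem notMem_self_iff (hπ : π.IsAssociatedTo I) : x ∉ I x ↔ π.perm x = x ∧ x ∉ π.black := by
  rw [hπ.mem_iff, not_or, val_sub_self, Nat.pos_iff_ne_zero, not_not, eq_comm (a := π.perm x),
    ← Equiv.symm_apply_eq]
  refine and_congr_left' ⟨fun h => val_sub_inj (h.trans (val_sub_self x).symm), fun h => ?_⟩
  rw [h, val_sub_self]

theorem cycLE_symm_iff (hπ : π.IsAssociatedTo I) (a x : Fin n) :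
    cycLE a x (π.perm.symm x) ↔ x ∈ I a ∨ x ∉ I x := by
  have hblack := π.perm_eq_of_mem_black x
  have hinj : (x - a).val = (π.perm.symm x - a).val ↔ π.perm x = x := by
    rw [eq_comm (a := π.perm x), ← Equiv.symm_apply_eq]
    exact ⟨fun h => (val_sub_inj h).symm, fun h => by rw [h]⟩
  rw [hπ.notMem_self_iff, hπ.mem_iff, cycLE, Fin.le_def, le_iff_lt_or_eq, hinj]
  tauto

variable [NeZero n]

theorem mem_black_iff (hπ : π.IsAssociatedTo I) : x ∈ π.black ↔ x ∈ I (x + 1) := by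
  have hlast := val_self_sub_succ x
  rw [hπ.mem_iff, or_iff_right (by omega)]

theorem perm_apply_eq_self_iff (hπ : π.IsAssociatedTo I) :
    π.perm x = x ↔ x ∉ I x ∨ x ∈ I (x + 1) := by
  rw [hπ.notMem_self_iff, ← hπ.mem_black_iff]
  have := π.perm_eq_of_mem_black x
  tauto

theorem perm_apply_eq (hπ : π.IsAssociatedTo I) (hi : j ∉ I i) (hi' : j ∈ I (i + 1)) :
    π.perm i = j := by
  rw [hπ.mem_iff, not_or] at hi
  have hlt := ((hπ.mem_iff _ _).1 hi').resolve_right hi.2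
  have hlast := val_self_sub_succ i
  rw [← Equiv.eq_symm_apply]
  by_contra hne
  have hp : (i - (i + 1)).val ≠ (π.perm.symm j - (i + 1)).val := fun e => hne (val_sub_inj e)
  have hle := hi.1
  rw [val_sub_rebase (i + 1) j i, val_sub_rebase (i + 1) (π.perm.symm j) i] at hle
  split_ifs at hle <;> omega

theorem perm_apply_notMem_and_mem (hπ : π.IsAssociatedTo I) (hi : π.perm i ≠ i) :
    π.perm i ∉ I i ∧ π.perm i ∈ I (i + 1) := by
  have hblack : π.perm i ∉ π.black := fun h =>
    hi (π.perm.injective (π.perm_eq_of_mem_black _ h))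
  have hlast := val_self_sub_succ i
  have hne : (π.perm i - (i + 1)).val ≠ (i - (i + 1)).val := fun e => hi (val_sub_inj e)
  simp only [hπ.mem_iff, Equiv.symm_apply_apply, val_sub_self, hblack, or_false, not_lt]
  omega

theorem unique (hπ : π.IsAssociatedTo I) (hπ' : π'.IsAssociatedTo I) : π = π' := by
  have hperm : π.perm = π'.perm := by
    refine Equiv.ext fun i => ?_
    by_cases hi' : π'.perm i = i
    · by_cases hi : π.perm i = i
      · rw [hi, hi']
      · obtain ⟨hout, hin⟩ := hπ.perm_apply_notMem_and_mem hi
        exact (hπ'.perm_apply_eq hout hin).symm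
    · obtain ⟨hout, hin⟩ := hπ'.perm_apply_notMem_and_mem hi'
      exact hπ.perm_apply_eq hout hin
  have hblack : π.black = π'.black := Set.ext fun x => by rw [hπ.mem_black_iff, hπ'.mem_black_iff]
  cases π
  congr

theorem cycLE_iff (hπ : π.IsAssociatedTo I) (a y : Fin n) :
    cycLE a (π.perm.symm y) y ↔ y ∉ I a ∨ y ∈ I (y + 1) := by
  have hblack (hy : y ∈ π.black) : π.perm.symm y = y := by
    rw [Equiv.symm_apply_eq, π.perm_eq_of_mem_black y hy]
  rw [← hπ.mem_black_iff, hπ.mem_iff, not_or, not_lt, cycLE, Fin.le_def]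
  constructor
  · tauto
  · rintro (h | h)
    · exact h.1
    · rw [hblack h]

end DecoratedPermutation.IsAssociatedTo

section Arrows

variable {n d : ℕ} [NeZero n] {I : Fin n → Finset (Fin n)} {M : Matroid (Fin n)}
  {π : DecoratedPermutation n}

theorem IsPositroidOf.perm_apply_eq_self_iff (hM : IsPositroidOf d I M) (hπ : π.IsAssociatedTo I)
    (x : Fin n) : π.perm x = x ↔ M.IsLoop x ∨ M.IsColoop x := by
  rw [hπ.perm_apply_eq_self_iff, hM.isLoop_iff, hM.isColoop_iff]

theorem IsPositroidOf.ccw_cycIoo (hM : IsPositroidOf d I M) (hπ : π.IsAssociatedTo I)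
    (a b : Fin n) :
    π.ccw (cycIoo b a) = minElts M (cycIoo b a) + (M.loops ∩ cycIoo b a).ncard := by
  have hmin := (isTight_iff_ncard_inter_compl (hM.isBase_necklace a)).1 (hM.isTight_necklace a b)
  have harrows : {x | cycIcc x (π.perm.symm x) ⊆ cycIoo b a} =
      ((I a : Set (Fin n)) ∩ cycIoo b a) ∪ (M.loops ∩ cycIoo b a) := by
    ext x
    have hloop : x ∈ M.loops ↔ x ∉ I x := hM.isLoop_iff
    rw [Set.mem_ofPred_eq, cycIcc_subset_cycIoo_iff, hπ.cycLE_symm_iff,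
      ← Set.union_inter_distrib_right, Set.mem_inter_iff, Set.mem_union, hloop, mem_coe, and_comm]
  have hdisj : Disjoint ((I a : Set (Fin n)) ∩ cycIoo b a) (M.loops ∩ cycIoo b a) :=
    (Set.disjoint_left.2 fun x hx hloop => hM.isLoop_iff.1 hloop (hM.necklace.mem_self hx)).mono
      Set.inter_subset_left Set.inter_subset_left
  rw [DecoratedPermutation.ccw, harrows, Set.ncard_union_eq hdisj]
  exact congrArg (· + _) hmin

theorem IsPositroidOf.rk_cycIcc_add_cw (hM : IsPositroidOf d I M) (hπ : π.IsAssociatedTo I)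
    {a b : Fin n} (hab : cycIcc a b ≠ Set.univ) :
    rk M (cycIcc a b) + π.cw (cycIcc a b) =
      (cycIcc a b).ncard + (M.coloops ∩ cycIcc a b).ncard := by
  have harrows : π.perm '' {x | cycIcc x (π.perm x) ⊆ cycIcc a b} =
      (cycIcc a b \ I a) ∪ (M.coloops ∩ cycIcc a b) := by
    ext y
    have hcoloop : y ∈ M.coloops ↔ y ∈ I (y + 1) := hM.isColoop_iff
    rw [Equiv.image_eq_preimage_symm, Set.mem_preimage, Set.mem_ofPred_eq, Equiv.apply_symm_apply,
      cycIcc_subset_cycIcc_iff hab, hπ.cycLE_iff, Set.mem_union, Set.mem_sdiff, Set.mem_inter_iff,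
      hcoloop, mem_coe]
    tauto
  have hdisj : Disjoint (cycIcc a b \ I a) (M.coloops ∩ cycIcc a b) :=
    Set.disjoint_left.2 fun x hx hcoloop =>
      hx.2 (hM.necklace.mem_of_mem_succ (hM.isColoop_iff.1 hcoloop.1))
  have hsplit := Set.ncard_inter_add_ncard_sdiff_eq_ncard (cycIcc a b) (I a : Set (Fin n))
  rw [Set.inter_comm, hM.isTight_necklace a b] at hsplit
  rw [DecoratedPermutation.cw, ← Set.ncard_image_of_injective _ π.perm.injective, harrows,
    Set.ncard_union_eq hdisj, ← hsplit]
  ring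

end Arrows

end Positroid

theorem mainTheorem1_general (n : ℕ) [NeZero n] (d : ℕ) (I : Fin n → Finset (Fin n))
    (M : Matroid (Fin n)) (hM : Positroid.IsPositroidOf d I M)
    (s : ℕ) (a b : Fin s → Fin n) (hab : Positroid.CyclicallyOrdered a b) :
    (∃ P : Finpartition (Finset.univ : Finset (Fin s)), Positroid.IsNonCrossing P ∧
      (Positroid.rk M (⋃ i, Positroid.cycIcc (a i) (b i)) : ℤ) =
        Positroid.nbdPartition M a b P) ∧
    IsLeast {k : ℤ | ∃ P : Finpartition (Finset.univ : Finset (Fin s)),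
        Positroid.IsNonCrossing P ∧ Positroid.nbdPartition M a b P = k}
      (Positroid.rk M (⋃ i, Positroid.cycIcc (a i) (b i)) : ℤ) ∧
    (∃! π : Positroid.DecoratedPermutation n, π.IsAssociatedTo I) ∧
    ∀ π : Positroid.DecoratedPermutation n, π.IsAssociatedTo I →
      (∀ x, π.perm x = x ↔ M.IsLoop x ∨ M.IsColoop x) ∧
      (∀ T : Finset (Fin s),
        Positroid.nbd M (Positroid.restrictBlock a T) (Positroid.restrictBlock b T) =
          (Positroid.rk M M.E : ℤ) - ∑ i : Fin T.card,
            ((π.ccw (Positroid.cycIoo (Positroid.restrictBlock b T i)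
              (Positroid.restrictBlock a T (finRotate T.card i))) : ℤ) -
              (M.loops ∩ Positroid.cycIoo (Positroid.restrictBlock b T i)
                (Positroid.restrictBlock a T (finRotate T.card i))).ncard)) ∧
      (∀ i : Fin s, Positroid.cycIcc (a i) (b i) ≠ Set.univ →
        Positroid.nbd M (Positroid.restrictBlock a {i}) (Positroid.restrictBlock b {i}) =
          ((Positroid.cycIcc (a i) (b i)).ncard : ℤ) -
            ((π.cw (Positroid.cycIcc (a i) (b i)) : ℤ) -
              (M.coloops ∩ Positroid.cycIcc (a i) (b i)).ncard)) := by
  obtain ⟨P, hP, hrk⟩ := hM.exists_isNonCrossing_rk_eq hab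
  refine ⟨⟨P, hP, hrk⟩, ⟨⟨P, hP, hrk.symm⟩, ?_⟩, ?_,
    fun π hπ => ⟨hM.perm_apply_eq_self_iff hπ, fun T => ?_, fun i hi => ?_⟩⟩
  · rintro _ ⟨Q, -, rfl⟩
    exact hab.rk_le_nbdPartition Q
  · obtain ⟨π, hπ⟩ := hM.necklace.exists_isAssociatedTo
    exact ⟨π, hπ, fun π' hπ' => hπ'.unique hπ⟩
  · simp only [Positroid.nbd, hM.ccw_cycIoo hπ, Nat.cast_add, add_sub_cancel_right]
  · have hcw := hM.rk_cycIcc_add_cw hπ hi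
    rw [Positroid.nbd_restrictBlock_singleton]
    omega

theorem mainTheorem1 (n : ℕ) [NeZero n] (d : ℕ) (I : Fin n → Finset (Fin n))
    (M : Matroid (Fin n)) (hM : Positroid.IsPositroidOf d I M)
    (hloop : ∀ e, ¬ M.IsLoop e) (hcoloop : ∀ e, ¬ M.IsColoop e)
    (s : ℕ) (a b : Fin s → Fin n) (hab : Positroid.CyclicallyOrdered a b) :
    -- the bound given by some non-crossing partition is attained
    (∃ P : Finpartition (Finset.univ : Finset (Fin s)), Positroid.IsNonCrossing P ∧
      (Positroid.rk M (⋃ i, Positroid.cycIcc (a i) (b i)) : ℤ) =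
        Positroid.nbdPartition M a b P) ∧
    -- the rank is the minimum of the bounds over all non-crossing partitions
    IsLeast {k : ℤ | ∃ P : Finpartition (Finset.univ : Finset (Fin s)),
        Positroid.IsNonCrossing P ∧ Positroid.nbdPartition M a b P = k}
      (Positroid.rk M (⋃ i, Positroid.cycIcc (a i) (b i)) : ℤ) ∧
    -- the bounds are given by arrow counts of the decorated permutation
    (∃! π : Positroid.DecoratedPermutation n, π.IsAssociatedTo I) ∧
    ∀ π : Positroid.DecoratedPermutation n, π.IsAssociatedTo I →
      (∀ x, π.perm x ≠ x) ∧
      (∀ T : Finset (Fin s), T.Nonempty →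
        Positroid.nbd M (Positroid.restrictBlock a T) (Positroid.restrictBlock b T) =
          (Positroid.rk M M.E : ℤ) - ∑ i : Fin T.card,
            (π.ccw (Positroid.cycIoo (Positroid.restrictBlock b T i)
              (Positroid.restrictBlock a T (finRotate T.card i))) : ℤ)) ∧
      (∀ i : Fin s, Positroid.cycIcc (a i) (b i) ≠ Set.univ →
        Positroid.nbd M (Positroid.restrictBlock a {i}) (Positroid.restrictBlock b {i}) =
          ((Positroid.cycIcc (a i) (b i)).ncard : ℤ) -
            (π.cw (Positroid.cycIcc (a i) (b i)) : ℤ)) := by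
  have hloops : M.loops = ∅ := Set.eq_empty_of_forall_notMem hloop
  have hcoloops : M.coloops = ∅ := Set.eq_empty_of_forall_notMem hcoloop
  obtain ⟨hex, hleast, hperm, hnbd⟩ := mainTheorem1_general n d I M hM s a b hab
  simp only [hloops, hcoloops, Set.empty_inter, Set.ncard_empty, Nat.cast_zero, sub_zero, hloop,
    hcoloop, or_self, iff_false] at hnbd
  exact ⟨hex, hleast, hperm, fun π hπ => (hnbd π hπ).imp_right (And.imp_left fun hT T _ => hT T)⟩
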